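/- All vector spaces are over $\mathbb{C}$. Let $V$ be a vertex algebra with vacuum $|0\rangle$ and state-field correspondence $Y$, let $\sigma$ be an automorphism of $V$ of finite order $N$, put $\epsilon=e^{2\pi i/N}$ and $V_j=\{a\in V:\sigma a=\epsilon^{-j}a\}$ for $0\le j\le N-1$. An $N$-twisted field on a vector space $M$ is a formal series $\phi(z)=\sum_{m\in\frac1N\mathbb{Z}}\phi_{(m)}z^{-m-1}$ with $\phi_{(m)}\in\operatorname{End}(M)$ such that for each $v\in M$ one has $\phi_{(m)}v=0$ for all sufficiently large $m$; write $\phi(e^{2\pi i}z)=\sum_m\phi_{(m)}e^{-2\pi i m}z^{-m-1}$. Below $i_{x,y}$ denotes expansion in the domain $|x|>|y|$. Let $M$ be a vector space and let $a\mapsto Y^M(a,z)=\sum_{m\in\frac1N\mathbb{Z}}a^M_{(m)}z^{-m-1}$ be a linear map from $V$ to the space of $N$-twisted fields on $M$. Then $(M,Y^M)$ is a $\sigma$-twisted $V$-module, i.e. it satisfies (1) $Y^M(\sigma a,z)=Y^M(a,e^{2\pi i}z)$ for all $a\in V$, (2) $Y^M(|0\rangle,z)=\mathrm{id}_M$, (3)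 the twisted Borcherds identity: for all $0\le j\le N-1$, $a\in V_j$, $b\in V$, and all rational functions $F(z,w)$ with poles only at $z=0$, $w=0$ or $z=w$, $$\operatorname{Res}_{z-w}Y^M(Y(a,z-w)b,w)\,i_{w,z-w}z^{j/N}F(z,w)=\operatorname{Res}_zY^M(a,z)Y^M(b,w)\,i_{z,w}z^{j/N}F(z,w)-\operatorname{Res}_zY^M(b,w)Y^M(a,z)\,i_{w,z}z^{j/N}F(z,w),$$ if and only if it satisfies (1), (2) and (4) associativity: for all $0\le j\le N-1$, $a\in V_j$, $b\in V$, $v\in M$ and all sufficiently large integers $n$ (depending on $a,b,v$), $$i_{w,z}(z+w)^{n+j/N}\,Y^M(Y(a,z)b,w)v=i_{z,w}(z+w)^{n+j/N}\,Y^M(a,z+w)Y^M(b,w)v.$$ The same equivalence holds if in (4) the identity is required for precisely specified exponents, namely for every integer $n\ge0$ such that $a^M_{(k+j/N)}v=0$ for all integers $k\ge n$ (so that the bound on $n$ does not depend on $b$). -/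

import Mathlib

noncomputable section

open scoped VertexOperator

/-- A vertex algebra over `ℂ`. A field on `V` is a linear map from `V` to Laurent series with
coefficients in `V`, that is, a `VertexOperator ℂ V`; its mode `φ_(m)`, the coefficient of
`z ^ (-m - 1)`, is `φ[[m]]`. -/
structure VertexAlgebra (V : Type*) [AddCommGroup V] [Module ℂ V] where
  /-- the vacuum vector -/
  vac : V
  /-- the infinitesimal translation operator -/
  T : Module.End ℂ V
  /-- the state-field correspondence `a ↦ Y(a, z)` -/
  Y : V →ₗ[ℂ] VertexOperator ℂ V
  /-- `(z - w) ^ L [Y(a, z), Y(b, w)] = 0` for some `L` (hence for all large `L`): the coefficient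
  of `z ^ (-m - 1) w ^ (-k - 1)` -/
  locality : ∀ a b : V, ∃ L : ℕ, ∀ m k : ℤ,
    ∑ i ∈ Finset.range (L + 1), ((-1 : ℂ) ^ i * (L.choose i : ℂ)) •
      ((Y a)[[m + L - i]] * (Y b)[[k + i]] - (Y b)[[k + i]] * (Y a)[[m + L - i]]) = 0
  /-- `[T, Y(a, z)] = ∂_z Y(a, z)` -/
  translation : ∀ (a : V) (m : ℤ),
    T * (Y a)[[m]] - (Y a)[[m]] * T = (-(m : ℂ)) • (Y a)[[m - 1]]
  /-- `Y(vac, z) = id` -/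
  vac_field : ∀ m : ℤ, (Y vac)[[m]] = if m = -1 then 1 else 0
  T_vac : T vac = 0
  /-- `Y(a, z) vac - a ∈ z V[[z]]` -/
  field_vac_nonneg : ∀ (a : V) (m : ℤ), 0 ≤ m → ((Y a)[[m]]) vac = 0
  field_vac : ∀ a : V, ((Y a)[[-1]]) vac = a

namespace VertexAlgebra

variable {V : Type*} [AddCommGroup V] [Module ℂ V]

/-- The mode `a_(x)` of `Y(a, z)` for a rational index `x`; it is `0` unless `x` is an integer. -/
def mode (A : VertexAlgebra V) (a : V) (x : ℚ) : Module.End ℂ V :=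
  if x = (⌊x⌋ : ℚ) then (A.Y a)[[⌊x⌋]] else 0

/-- A linear bijection `σ` is an automorphism of the vertex algebra if it fixes the vacuum and
satisfies `σ (a_(m) b) = (σ a)_(m) (σ b)`. It then commutes with `T`, as `T a = a_(-2) vac`. -/
structure IsAutomorphism (A : VertexAlgebra V) (σ : V ≃ₗ[ℂ] V) : Prop where
  map_vac : σ A.vac = A.vac
  map_mode : ∀ (a b : V) (m : ℤ), σ (((A.Y a)[[m]]) b) = ((A.Y (σ a))[[m]]) (σ b)

end VertexAlgebra

/-- `N`-twisted fields on `M`: formal series `φ(z) = ∑ φ_(m) z ^ (-m - 1)` over `m ∈ (1/N) ℤ` with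
`φ_(m) ∈ End M`, such that for every `v` one has `φ_(m) v = 0` for all large `m`. Such a series is
recorded as the function `m ↦ φ_(m)` on `ℚ`, which vanishes outside `(1/N) ℤ`. -/
def TwistedField (N : ℕ) (M : Type*) [AddCommGroup M] [Module ℂ M] :
    Submodule ℂ (ℚ → Module.End ℂ M) where
  carrier := {φ | (∀ m : ℚ, (¬ ∃ r : ℤ, m = (r : ℚ) / (N : ℚ)) → φ m = 0) ∧
    ∀ v : M, ∃ B : ℚ, ∀ m : ℚ, B ≤ m → φ m v = 0}
  zero_mem' := ⟨fun _ _ => rfl, fun _ => ⟨0, fun _ _ => rfl⟩⟩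
  add_mem' := by
    rintro φ ψ ⟨h1, h2⟩ ⟨k1, k2⟩
    refine ⟨fun m hm => by simp [h1 m hm, k1 m hm], fun v => ?_⟩
    obtain ⟨B, hB⟩ := h2 v
    obtain ⟨C, hC⟩ := k2 v
    exact ⟨max B C, fun m hm => by
      simp [hB m (le_trans (le_max_left _ _) hm), hC m (le_trans (le_max_right _ _) hm)]⟩
  smul_mem' := by
    rintro c φ ⟨h1, h2⟩
    refine ⟨fun m hm => by simp [h1 m hm], fun v => ?_⟩
    obtain ⟨B, hB⟩ := h2 v
    exact ⟨B, fun m hm => by simp [hB m hm]⟩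

/-- A formal series `∑ S α β x ^ α y ^ β` in two variables with rational exponents and
coefficients in `X`. -/
abbrev Series₂ (X : Type*) := ℚ → ℚ → X

namespace Series₂

/-- The product of a scalar series and a series with coefficients in a vector space. (It is only
used where every coefficient of the product is a finite sum.) -/
def mul {X : Type*} [AddCommGroup X] [Module ℂ X] (f : Series₂ ℂ) (S : Series₂ X) : Series₂ X :=
  fun α β => ∑ᶠ e : ℚ × ℚ, f e.1 e.2 • S (α - e.1) (β - e.2)

/-- The same series with the two variables listed in the opposite order. -/
def swap {X : Type*} (S : Series₂ X) : Series₂ X := fun α β => S β α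

/-- The residue in the first variable `x`, that is, the coefficient of `x ^ (-1)`: a series in the
second variable. -/
def res {X : Type*} (S : Series₂ X) : ℚ → X := S (-1)

/-- The expansion `i_{x,y} (x + c y) ^ s = ∑_{i ≥ 0} binom(s, i) c ^ i x ^ (s - i) y ^ i` in the
domain `|x| > |y|`. -/
def binomial (c : ℂ) (s : ℚ) : Series₂ ℂ := fun α β =>
  if β = (⌊β⌋₊ : ℚ) ∧ α + β = s then ((Ring.choose s ⌊β⌋₊ : ℚ) : ℂ) * c ^ ⌊β⌋₊ else 0

end Series₂

/-- A presentation `F(z, w) = P(z, w) / (z ^ p * w ^ q * (z - w) ^ n)` of a rational function with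
poles only at `z = 0`, `w = 0` or `z = w`; `P` is a polynomial in `z` (variable `0`) and `w`
(variable `1`). -/
structure RatFun where
  P : MvPolynomial (Fin 2) ℂ
  p : ℕ
  q : ℕ
  n : ℕ

namespace RatFun

/-- `i_{z,w} z ^ s F(z, w)`, as a series in `z, w`. -/
def expandZW (F : RatFun) (s : ℚ) : Series₂ ℂ := fun α β =>
  ∑ d ∈ F.P.support, F.P.coeff d *
    Series₂.binomial (-1) (-(F.n : ℚ)) (α - (s + d 0 - F.p)) (β - (d 1 - F.q))

/-- `i_{w,z} z ^ s F(z, w)`, as a series in `z, w`; here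
`(z - w) ^ (-n) = (-1) ^ n (w - z) ^ (-n)`. -/
def expandWZ (F : RatFun) (s : ℚ) : Series₂ ℂ := fun α β =>
  ∑ d ∈ F.P.support, F.P.coeff d * ((-1) ^ F.n *
    Series₂.binomial (-1) (-(F.n : ℚ)) (β - (d 1 - F.q)) (α - (s + d 0 - F.p)))

/-- `i_{w,z-w} z ^ s F(z, w)`, as a series in `t = z - w` and `w` (in this order); here
`z ^ (s + k)` becomes `i_{w,t} (w + t) ^ (s + k)`. -/
def expandWT (F : RatFun) (s : ℚ) : Series₂ ℂ := fun α β =>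
  ∑ d ∈ F.P.support, F.P.coeff d *
    Series₂.binomial 1 (s + d 0 - F.p) (β - (d 1 - F.q)) (α + F.n)

end RatFun

namespace VertexAlgebra

variable {V : Type*} [AddCommGroup V] [Module ℂ V] (A : VertexAlgebra V) (σ : V ≃ₗ[ℂ] V) {N : ℕ}
  {M : Type*} [AddCommGroup M] [Module ℂ M] (Y : V →ₗ[ℂ] TwistedField N M)

/-- The mode `a^M_(m)`, that is, the coefficient of `z ^ (-m - 1)` in `Y^M(a, z)`. -/
def tmode (a : V) (m : ℚ) : Module.End ℂ M := (Y a : ℚ → Module.End ℂ M) m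

/-- `Y^M(a, z) Y^M(b, w) v` as a series in `z, w`. -/
def prodSeries (a b : V) (v : M) : Series₂ M := fun α β =>
  tmode Y a (-α - 1) (tmode Y b (-β - 1) v)

/-- `Y^M(Y(a, t) b, w) v` as a series in `t, w`. -/
def iterSeries (a b : V) (v : M) : Series₂ M := fun α β =>
  tmode Y (A.mode a (-α - 1) b) (-β - 1) v

/-- `Y^M(a, z + w) Y^M(b, w) v` as a series in `z, w`, where `Y^M(a, z + w)` stands for
`∑_m a^M_(m) i_{z,w} (z + w) ^ (-m - 1)`. -/
def shiftedProdSeries (a b : V) (v : M) : Series₂ M := fun α β =>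
  ∑ᶠ e : ℚ × ℚ, Series₂.binomial 1 (-e.1 - 1) α (β + e.2 + 1) •
    tmode Y a e.1 (tmode Y b e.2 v)

/-- `a ∈ V_j`, that is, `σ a = ε ^ (-j) a` with `ε = exp (2 π i / N)`. -/
def InEigenspace (N : ℕ) (j : ℕ) (a : V) : Prop :=
  σ a = Complex.exp (-(2 * Real.pi * Complex.I * j / N)) • a

/-- `Y^M(σ a, z) = Y^M(a, e^{2 π i} z)`. -/
def IsEquivariant : Prop := ∀ (a : V) (m : ℚ),
  tmode Y (σ a) m = Complex.exp (-(2 * Real.pi * Complex.I * m)) • tmode Y a m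

/-- `Y^M(vac, z) = id_M`. -/
def SatisfiesVacuum : Prop := ∀ m : ℚ, tmode Y A.vac m = if m = -1 then 1 else 0

/-- The twisted Borcherds identity: for `a ∈ V_j`, `b ∈ V` and `F`,
`Res_{z-w} Y^M(Y(a, z-w) b, w) i_{w,z-w} z^{j/N} F(z, w)`
`= Res_z Y^M(a, z) Y^M(b, w) i_{z,w} z^{j/N} F(z, w)`
`- Res_z Y^M(b, w) Y^M(a, z) i_{w,z} z^{j/N} F(z, w)`,
evaluated on every `v ∈ M`, as an equality of series in `w`. -/
def SatisfiesTwistedBorcherds : Prop :=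
  ∀ j : ℕ, j < N → ∀ a : V, InEigenspace σ N j a → ∀ (b : V) (F : RatFun) (v : M) (β : ℚ),
    (Series₂.mul (F.expandWT ((j : ℚ) / N)) (iterSeries A Y a b v)).res β =
      (Series₂.mul (F.expandZW ((j : ℚ) / N)) (prodSeries Y a b v)).res β -
      (Series₂.mul (F.expandWZ ((j : ℚ) / N)) (prodSeries Y b a v).swap).res β

/-- `M` with `Y^M` is a `σ`-twisted `V`-module. -/
structure IsTwistedModule : Prop where
  equivariant : IsEquivariant σ Y
  vacuum : SatisfiesVacuum A Y
  borcherds : SatisfiesTwistedBorcherds A σ Y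

/-- `i_{w,z} (z + w) ^ s Y^M(Y(a, z) b, w) v = i_{z,w} (z + w) ^ s Y^M(a, z + w) Y^M(b, w) v`
as series in `z, w`. -/
def AssocIdentity (s : ℚ) (a b : V) (v : M) : Prop :=
  Series₂.mul (Series₂.binomial 1 s).swap (iterSeries A Y a b v) =
    Series₂.mul (Series₂.binomial 1 s) (shiftedProdSeries Y a b v)

/-- Associativity: for `a ∈ V_j`, `b ∈ V`, `v ∈ M`, the identity with exponent `n + j / N` holds
for all large `n`. -/
def SatisfiesAssociativity : Prop :=
  ∀ j : ℕ, j < N → ∀ a : V, InEigenspace σ N j a → ∀ (b : V) (v : M),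
    ∃ n₀ : ℕ, ∀ n : ℕ, n₀ ≤ n → AssocIdentity A Y ((n : ℚ) + (j : ℚ) / N) a b v

/-- Associativity with the explicit range of exponents: for `a ∈ V_j`, `b ∈ V`, `v ∈ M`, the
identity with exponent `n + j / N` holds for every `n ≥ 0` such that `a^M_(k + j/N) v = 0` for
all `k ≥ n`. -/
def SatisfiesExplicitAssociativity : Prop :=
  ∀ j : ℕ, j < N → ∀ a : V, InEigenspace σ N j a → ∀ (b : V) (v : M) (n : ℕ),
    (∀ k : ℕ, n ≤ k → tmode Y a ((k : ℚ) + (j : ℚ) / N) v = 0) →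
      AssocIdentity A Y ((n : ℚ) + (j : ℚ) / N) a b v

end VertexAlgebra

end

/-! Tested against the monomial `z^(s+m) w^k (z-w)^n` with `s = j/N`, the Borcherds identity says
that a defect `D(m,n,k)` (`twDefect`) vanishes: iterate minus product plus the signed reversed
product. Splitting one factor `z - w` gives `D(m,n+1,k) = D(m+1,n,k) - D(m,n,k+1)`. If the modes `s
+ q` of `a`, `q ≥ m`, kill `v`, the reversed product contributes nothing, and the vanishing of
`D(m,n,k)` for all `n`, `k` and all cosets of `w`-exponents is exactly associativity with exponent
`m + s` (`assocIdentity_iff`). Hence Borcherds gives explicit associativity, and associativity gives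
`D = 0` for large `m`.

For the converse, `D` must also vanish for large `k`. Associativity against the vacuum gives
`Y^M(Ta,z) = ∂_z Y^M(a,z)` (`tmode_T`). Together with skew-symmetry in `V` this identifies, up to
sign, the defect of `(a,b)` with that of `(b,a)` after exchanging `m` and `k` (`twDefect_skew`), and
associativity for `(b,a)` applies. The recursion expresses `D(m,n,k)` through defects with larger `m
+ k`, so it vanishes everywhere (`eq_zero_of_recursion`). Skew-symmetry is itself derived from
locality, by proving the Borcherds identity on the vacuum (`borcherdsDefect_vac`). -/

noncomputable section

open Finset

/-! ### Binomial coefficients, finite sums, and vanishing from a recursion -/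

/-- The binomial coefficient `binom(x, i)` as a complex number. -/
def cchoose (x : ℚ) (i : ℕ) : ℂ := ((Ring.choose x i : ℚ) : ℂ)

theorem cchoose_zero (x : ℚ) : cchoose x 0 = 1 := by simp [cchoose]

theorem cchoose_zero_succ (i : ℕ) : cchoose 0 (i + 1) = 0 := by simp [cchoose]

theorem cchoose_one (x : ℚ) : cchoose x 1 = x := by simp [cchoose]

theorem cchoose_succ_succ (x : ℚ) (i : ℕ) :
    cchoose (x + 1) (i + 1) = cchoose x i + cchoose x (i + 1) := by
  simp [cchoose, Ring.choose_succ_succ]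

theorem cchoose_natCast (n i : ℕ) : cchoose n i = n.choose i := by
  simp [cchoose, Ring.choose_natCast]

theorem cchoose_add (x y : ℚ) (p : ℕ) :
    cchoose (x + y) p = ∑ ij ∈ antidiagonal p, cchoose x ij.1 * cchoose y ij.2 := by
  simp [cchoose, Ring.add_choose_eq p (Commute.all x y)]

theorem succ_mul_cchoose_succ (x : ℚ) (i : ℕ) :
    ((i : ℂ) + 1) * cchoose x (i + 1) = x * cchoose (x - 1) i := by
  have h := Ring.choose_smul_choose x (n := i + 1) (k := 1) (by omega)
  simp only [Nat.choose_one_right, Ring.choose_one_right, Nat.add_sub_cancel, nsmul_eq_mul,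
    Nat.cast_one] at h
  have := congrArg (fun q : ℚ => (q : ℂ)) h
  simpa [cchoose] using this

theorem succ_mul_cchoose_succ' (x : ℚ) (i : ℕ) :
    ((i : ℂ) + 1) * cchoose x (i + 1) = (x - i) * cchoose x i := by
  have h := Ring.choose_smul_choose x (n := i + 1) (k := i) (by omega)
  simp only [Nat.choose_succ_self_right, Ring.choose_one_right, Nat.add_sub_cancel_left,
    nsmul_eq_mul] at h
  have := congrArg (fun q : ℚ => (q : ℂ)) h
  rw [mul_comm (Ring.choose x i)] at this
  simpa [cchoose] using this

theorem cchoose_neg (x : ℚ) (i : ℕ) :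
    cchoose (-x) i = (-1) ^ i * cchoose (x + i - 1) i := by
  have h := Ring.choose_neg x i
  rw [Units.smul_def, zsmul_eq_mul] at h
  simp [cchoose, h, Int.negOnePow]

theorem cchoose_neg_one (i : ℕ) : cchoose (-1) i = (-1) ^ i := by
  rw [cchoose_neg, show (1 : ℚ) + i - 1 = i by ring, cchoose_natCast]; simp

theorem neg_one_pow_mul_neg_one_pow (i : ℕ) : (-1 : ℂ) ^ i * (-1) ^ i = 1 := by
  rw [← mul_pow]; simp

theorem finsum_nat_eq_sum_range {X : Type*} [AddCommMonoid X] {F : ℕ → X} {K : ℕ}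
    (h : ∀ i, K ≤ i → F i = 0) : ∑ᶠ i, F i = ∑ i ∈ range K, F i := by
  refine finsum_eq_sum_of_support_subset F fun i hi => ?_
  by_contra hc
  exact hi (h i (by simpa using hc))

theorem sum_range_sum_range_eq_sum_antidiagonal {X : Type*} [AddCommMonoid X]
    {F : ℕ → ℕ → X} {K : ℕ}
    (h : ∀ i l, K ≤ i + l → F i l = 0) :
    ∑ i ∈ range K, ∑ l ∈ range K, F i l =
      ∑ p ∈ range K, ∑ ij ∈ antidiagonal p, F ij.1 ij.2 := by
  simp only [Nat.sum_antidiagonal_eq_sum_range_succ (f := F)]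
  rw [sum_range_diag_flip]
  refine sum_congr rfl fun i _ => ?_
  symm
  refine sum_subset (fun l hl => ?_) fun l _ hl => h i l ?_
  · simp at hl ⊢; omega
  · simp at hl; omega

/-- Both defects on the right of `hD` have a larger `m + k`, so downward induction on `m + k` ends
in one of the two regions where `D` is known to vanish. -/
theorem eq_zero_of_recursion {X : Type*} [AddCommGroup X] {D : ℤ → ℤ → ℤ → X}
    (hD : ∀ m n k, D m (n + 1) k = D (m + 1) n k - D m n (k + 1)) {m₀ k₀ : ℤ}
    (hm : ∀ m n k, m₀ ≤ m → D m n k = 0) (hk : ∀ m n k, k₀ ≤ k → D m n k = 0) (m n k : ℤ) :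
    D m n k = 0 := by
  have key : ∀ (c : ℕ) (m n k : ℤ), m₀ - m + (k₀ - k) ≤ c → D m n k = 0 := by
    intro c
    induction c with
    | zero =>
      intro m n k h
      by_cases h' : m₀ ≤ m
      · exact hm m n k h'
      · exact hk m n k (by push_cast at h; omega)
    | succ c ih =>
      intro m n k h
      have := hD m (n - 1) k
      rw [ih (m + 1) _ k (by push_cast at h; omega), ih m _ (k + 1) (by push_cast at h; omega)]
        at this
      simpa using this
  exact key (m₀ - m + (k₀ - k)).toNat m n k (by omega)

/-- Solved for `D (m + 1) n k`, the recursion carries the vanishing from `m₀` upwards. Solved for `D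
m n (k + 1)`, it raises `m` or `n` at the cost of shifting `k`, which reaches every `m` below `m₀`.
-/
theorem eq_zero_of_recursion' {X : Type*} [AddCommGroup X] {D : ℤ → ℤ → ℤ → X}
    (hD : ∀ m n k, D m (n + 1) k = D (m + 1) n k - D m n (k + 1)) {m₀ n₀ : ℤ}
    (hm : ∀ n k, D m₀ n k = 0) (hn : ∀ m n k, n₀ ≤ n → D m n k = 0) (m n k : ℤ) :
    D m n k = 0 := by
  have hm' : ∀ (c : ℕ) (n k : ℤ), D (m₀ + c) n k = 0 := by
    intro c
    induction c with
    | zero => simpa using hm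
    | succ c ih =>
      intro n k
      have := hD (m₀ + c) n k
      rw [ih, ih, sub_zero] at this
      rw [this]
      congr 1
      push_cast
      ring
  have key : ∀ (c : ℕ) (m n k : ℤ), m₀ - m + (n₀ - n) ≤ c → D m n k = 0 := by
    intro c
    induction c with
    | zero =>
      intro m n k h
      by_cases h' : m₀ ≤ m
      · obtain ⟨d, rfl⟩ := Int.le.dest h'
        exact hm' d n k
      · exact hn m n k (by push_cast at h; omega)
    | succ c ih =>
      intro m n k h
      have := hD m n (k - 1)
      rw [ih _ _ _ (by push_cast at h; omega), ih _ _ _ (by push_cast at h; omega)] at this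
      simpa using this
  exact key (m₀ - m + (n₀ - n)).toNat m n k (by omega)

/-! ### Residues against monomials and their recursions -/

variable {M : Type*} [AddCommGroup M] [Module ℂ M]

theorem sum_cchoose_succ (x : ℚ) (G : ℕ → M) (K : ℕ) :
    ∑ i ∈ range (K + 1), cchoose (x + 1) i • G i =
      ∑ i ∈ range (K + 1), cchoose x i • G i + ∑ i ∈ range K, cchoose x i • G (i + 1) := by
  rw [sum_range_succ', sum_range_succ']
  simp only [cchoose_succ_succ, cchoose_zero, add_smul, sum_add_distrib]
  abel

/-- `Res` of `Y(Y(a, z - w) b, w)` against `z ^ (s + m) w ^ k (z - w) ^ n`, where `g n q` stands for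
the modes of `a_(n) b`. -/
def iterSum (s : ℚ) (g : ℤ → ℤ → M) (m n k : ℤ) : M :=
  ∑ᶠ i : ℕ, cchoose (s + m) i • g (n + i) (m + k - i)

/-- `Res` of `Y(a, z) Y(b, w)` against `z ^ m w ^ k (z - w) ^ n`, where `f p q` stands for the
product of the modes `p` of `a` and `q` of `b`. -/
def prodSum (f : ℤ → ℤ → M) (m n k : ℤ) : M :=
  ∑ᶠ i : ℕ, ((-1) ^ i * cchoose n i) • f (m + n - i) (k + i)

/-- The failure of the Borcherds identity for the monomial `z ^ (s + m) w ^ k (z - w) ^ n`. -/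
def borcherdsDefect (s : ℚ) (g f f' : ℤ → ℤ → M) (m n k : ℤ) : M :=
  iterSum s g m n k - prodSum f m n k + (-1 : ℂ) ^ n • prodSum f' k n m

theorem iterSum_eq_sum {g : ℤ → ℤ → M} {L : ℤ} (hg : ∀ n q, L ≤ n → g n q = 0) (s : ℚ)
    {m n k : ℤ} {K : ℕ} (hK : L ≤ n + K) :
    iterSum s g m n k = ∑ i ∈ range K, cchoose (s + m) i • g (n + i) (m + k - i) :=
  finsum_nat_eq_sum_range fun i hi => by rw [hg _ _ (by omega), smul_zero]

theorem prodSum_eq_sum {f : ℤ → ℤ → M} {B : ℤ} (hf : ∀ p q, B ≤ q → f p q = 0)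
    {m n k : ℤ} {K : ℕ} (hK : B ≤ k + K) :
    prodSum f m n k = ∑ i ∈ range K, ((-1) ^ i * cchoose n i) • f (m + n - i) (k + i) :=
  finsum_nat_eq_sum_range fun i hi => by rw [hf _ _ (by omega), smul_zero]

theorem iterSum_eq_zero {g : ℤ → ℤ → M} {L : ℤ} (hg : ∀ n q, L ≤ n → g n q = 0) (s : ℚ)
    {m n k : ℤ} (h : L ≤ n) : iterSum s g m n k = 0 := by
  rw [iterSum_eq_sum hg s (K := 0) (by simpa using h)]; simp

theorem prodSum_eq_zero {f : ℤ → ℤ → M} {B : ℤ} (hf : ∀ p q, B ≤ q → f p q = 0)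
    {m n k : ℤ} (h : B ≤ k) : prodSum f m n k = 0 := by
  rw [prodSum_eq_sum hf (K := 0) (by simpa using h)]; simp

theorem iterSum_add {g g' : ℤ → ℤ → M} {L L' : ℤ} (hg : ∀ n q, L ≤ n → g n q = 0)
    (hg' : ∀ n q, L' ≤ n → g' n q = 0) (s : ℚ) (m n k : ℤ) :
    iterSum s (g + g') m n k = iterSum s g m n k + iterSum s g' m n k := by
  set K := (max L L' - n).toNat
  rw [iterSum_eq_sum hg s (K := K) (by omega), iterSum_eq_sum hg' s (K := K) (by omega),
    iterSum_eq_sum (g := g + g') (L := max L L') (fun n q hn => ?_) s (K := K) (by omega),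
    ← sum_add_distrib]
  · exact sum_congr rfl fun i _ => smul_add _ _ _
  · simp [hg n q (by omega), hg' n q (by omega)]

theorem prodSum_add {f f' : ℤ → ℤ → M} {B B' : ℤ} (hf : ∀ p q, B ≤ q → f p q = 0)
    (hf' : ∀ p q, B' ≤ q → f' p q = 0) (m n k : ℤ) :
    prodSum (f + f') m n k = prodSum f m n k + prodSum f' m n k := by
  set K := (max B B' - k).toNat
  rw [prodSum_eq_sum hf (K := K) (by omega), prodSum_eq_sum hf' (K := K) (by omega),
    prodSum_eq_sum (f := f + f') (B := max B B') (fun p q hq => ?_) (K := K) (by omega),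
    ← sum_add_distrib]
  · exact sum_congr rfl fun i _ => smul_add _ _ _
  · simp [hf p q (by omega), hf' p q (by omega)]

/-- This is `z = w + (z - w)`, that is, Pascal's rule for the expansion of `z^(s+m+1)`. -/
theorem iterSum_succ {g : ℤ → ℤ → M} {L : ℤ} (hg : ∀ n q, L ≤ n → g n q = 0) (s : ℚ)
    (m n k : ℤ) :
    iterSum s g (m + 1) n k = iterSum s g m n (k + 1) + iterSum s g m (n + 1) k := by
  set K := (L - n).toNat
  have hK : L ≤ n + K := by omega
  rw [iterSum_eq_sum hg s (K := K + 1) (by push_cast; omega),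
    iterSum_eq_sum hg s (K := K + 1) (by push_cast; omega),
    iterSum_eq_sum hg s (K := K) (by omega)]
  have h := sum_cchoose_succ (s + m) (fun i => g (n + i) (m + 1 + k - i)) K
  rw [show s + (m + 1 : ℤ) = s + m + 1 by push_cast; ring, h]
  congr 1
  · exact sum_congr rfl fun i _ => by rw [show m + 1 + k - (i : ℤ) = m + (k + 1) - i by ring]
  · refine sum_congr rfl fun i _ => ?_
    push_cast
    rw [show n + ((i : ℤ) + 1) = n + 1 + i by ring,
      show m + 1 + k - ((i : ℤ) + 1) = m + k - i by ring]

theorem prodSum_succ {f : ℤ → ℤ → M} {B : ℤ} (hf : ∀ p q, B ≤ q → f p q = 0) (m n k : ℤ) :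
    prodSum f m (n + 1) k = prodSum f (m + 1) n k - prodSum f m n (k + 1) := by
  set K := (B - k).toNat
  have hK : B ≤ k + K := by omega
  rw [prodSum_eq_sum hf (K := K + 1) (by push_cast; omega),
    prodSum_eq_sum hf (K := K + 1) (by push_cast; omega),
    prodSum_eq_sum hf (K := K) (by omega)]
  have h := sum_cchoose_succ (n : ℚ) (fun i => (-1 : ℂ) ^ i • f (m + (n + 1) - i) (k + i)) K
  simp only [smul_smul] at h
  simp only [mul_comm ((-1 : ℂ) ^ _) (cchoose _ _)]
  push_cast
  rw [h, sub_eq_add_neg, ← sum_neg_distrib]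
  congr 1
  · exact sum_congr rfl fun i _ => by rw [show m + (n + 1) - (i : ℤ) = m + 1 + n - i by ring]
  · refine sum_congr rfl fun i _ => ?_
    push_cast
    rw [← neg_smul, pow_succ, show m + (n + 1) - ((i : ℤ) + 1) = m + n - i by ring,
      show k + ((i : ℤ) + 1) = k + 1 + i by ring]
    ring_nf

theorem borcherdsDefect_succ {g f f' : ℤ → ℤ → M} {L B B' : ℤ}
    (hg : ∀ n q, L ≤ n → g n q = 0) (hf : ∀ p q, B ≤ q → f p q = 0)
    (hf' : ∀ p q, B' ≤ q → f' p q = 0) (s : ℚ) (m n k : ℤ) :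
    borcherdsDefect s g f f' m (n + 1) k =
      borcherdsDefect s g f f' (m + 1) n k - borcherdsDefect s g f f' m n (k + 1) := by
  simp only [borcherdsDefect]
  rw [iterSum_succ hg, prodSum_succ hf, prodSum_succ hf', zpow_add_one₀ (by norm_num)]
  module

/-- Here `T` acts as `∂_z + ∂_w`. Integrating by parts, only `z^m` and `w^k` are differentiated,
because `∂_z + ∂_w` kills `(z - w)^n`. -/
theorem map_prodSum {f : ℤ → ℤ → M} {B : ℤ} (hf : ∀ p q, B ≤ q → f p q = 0)
    (T : M →ₗ[ℂ] M) (hT : ∀ p q, T (f p q) = (-(p : ℂ)) • f (p - 1) q + (-(q : ℂ)) • f p (q - 1))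
    (m n k : ℤ) :
    T (prodSum f m n k) =
      (-(m : ℂ)) • prodSum f (m - 1) n k + (-(k : ℂ)) • prodSum f m n (k - 1) := by
  set K := (B - k + 1).toNat
  have hK : B ≤ k - 1 + K := by omega
  rw [prodSum_eq_sum hf (m := m) (K := K) (by omega), prodSum_eq_sum hf (m := m - 1) (K := K)
    (by omega), prodSum_eq_sum hf (k := k - 1) (K := K) hK, map_sum, smul_sum, smul_sum]
  -- `G` collects the terms from differentiating `(z - w)^n`; its shifted and unshifted sums agree
  -- because both boundary terms vanish, so the two contributions cancel.
  set G : ℕ → M := fun i => ((-1) ^ i * ((i : ℂ) * cchoose n i)) • f (m + n - i) (k - 1 + i)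
  have hG : ∑ i ∈ range K, G (i + 1) = ∑ i ∈ range K, G i := by
    have h1 := sum_range_succ G K
    have h2 := sum_range_succ' G K
    have h3 : G K = 0 := by simp only [G]; rw [hf _ _ hK, smul_zero]
    have h4 : G 0 = 0 := by simp [G]
    rw [h3, add_zero] at h1
    rw [h4, add_zero] at h2
    rw [← h2, h1]
  rw [← sum_add_distrib, ← add_zero (∑ i ∈ range K, (_ + _)), ← sub_self (∑ i ∈ range K, G i)]
  nth_rewrite 1 [← hG]
  rw [← sum_sub_distrib, ← sum_add_distrib]
  refine sum_congr rfl fun i _ => ?_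
  have hc := succ_mul_cchoose_succ' n i
  simp only [G]
  rw [map_smul, hT, show k - 1 + ((i + 1 : ℕ) : ℤ) = k + i by push_cast; ring,
    show m + n - ((i + 1 : ℕ) : ℤ) = m - 1 + n - i by push_cast; ring,
    show m + n - (i : ℤ) - 1 = m - 1 + n - i by ring, show k + (i : ℤ) - 1 = k - 1 + i by ring]
  push_cast
  rw [hc, pow_succ]
  push_cast
  module

/-! ### Borcherds identity on the vacuum and skew-symmetry in `V` -/

open scoped VertexOperator

namespace VertexAlgebra

variable {V : Type*} [AddCommGroup V] [Module ℂ V] (A : VertexAlgebra V)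

theorem exists_ncoeff_eq_zero (a b : V) : ∃ L : ℕ, ∀ n : ℤ, L ≤ n → ((A.Y a)[[n]]) b = 0 := by
  refine ⟨(-HahnSeries.order ((HahnModule.of ℂ).symm (A.Y a b))).toNat, fun n hn => ?_⟩
  exact VertexOperator.ncoeff_eq_zero_of_lt_order _ _ _ (by omega)

/-- `a_(q) vac`; for `q = -1 - i` this is `T ^ i a / i!`. -/
def vacMode (q : ℤ) : V →ₗ[ℂ] V where
  toFun a := ((A.Y a)[[q]]) A.vac
  map_add' a b := by simp
  map_smul' c a := by simp

theorem vacMode_of_nonneg {q : ℤ} (hq : 0 ≤ q) (a : V) : A.vacMode q a = 0 :=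
  A.field_vac_nonneg a q hq

theorem vacMode_neg_one (a : V) : A.vacMode (-1) a = a := A.field_vac a

theorem T_ncoeff (a b : V) (m : ℤ) : A.T (((A.Y a)[[m]]) b) =
    (-(m : ℂ)) • ((A.Y a)[[m - 1]]) b + ((A.Y a)[[m]]) (A.T b) := by
  have := LinearMap.congr_fun (A.translation a m) b
  simp only [LinearMap.sub_apply, Module.End.mul_apply, LinearMap.smul_apply] at this
  rw [← this]; abel

theorem T_vacMode (a : V) (q : ℤ) : A.T (A.vacMode q a) = (-(q : ℂ)) • A.vacMode (q - 1) a := by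
  have := A.T_ncoeff a A.vac q
  rwa [A.T_vac, map_zero, add_zero] at this

/-- The coefficients of `Y(a, z) Y(b, w) vac`. -/
def vacProd (a b : V) (p q : ℤ) : V := ((A.Y a)[[p]]) (A.vacMode q b)

/-- The coefficients of `Y(Y(a, t) b, w) vac`. -/
def vacIter (a b : V) (n q : ℤ) : V := A.vacMode q (((A.Y a)[[n]]) b)

theorem vacProd_eq_zero (a b : V) (p q : ℤ) (hq : 0 ≤ q) : A.vacProd a b p q = 0 := by
  rw [vacProd, A.vacMode_of_nonneg hq, map_zero]

theorem T_vacProd (a b : V) (p q : ℤ) : A.T (A.vacProd a b p q) =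
    (-(p : ℂ)) • A.vacProd a b (p - 1) q + (-(q : ℂ)) • A.vacProd a b p (q - 1) := by
  rw [vacProd, T_ncoeff, T_vacMode, map_smul]; rfl

/-- The `n`-th product formula on the vacuum. Both sides vanish for `k ≥ 0` and agree at `k = -1`;
applying `T` passes from `k` to `k - 1` with the same factor `-k`, nonzero for `k < 0`. -/
theorem vacMode_ncoeff (a b : V) (n k : ℤ) :
    A.vacMode k (((A.Y a)[[n]]) b) = prodSum (A.vacProd a b) 0 n k := by
  have hz := A.vacProd_eq_zero a b
  rcases le_or_gt 0 k with hk | hk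
  · rw [A.vacMode_of_nonneg hk, prodSum_eq_zero hz hk]
  obtain ⟨q, rfl⟩ : ∃ q : ℕ, k = -1 - q := ⟨(-1 - k).toNat, by omega⟩
  clear hk
  induction q with
  | zero =>
    rw [prodSum_eq_sum hz (K := 1) (by simp)]
    simp [vacProd, vacMode_neg_one, cchoose_zero]
  | succ q ih =>
    have h1 := A.T_vacMode (((A.Y a)[[n]]) b) (-1 - q)
    rw [ih, map_prodSum hz A.T (A.T_vacProd a b)] at h1
    simp only [Int.cast_zero, neg_zero, zero_smul, zero_add] at h1
    have hq : (-((-1 - q : ℤ) : ℂ)) ≠ 0 := by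
      rw [neg_ne_zero]; exact_mod_cast (by omega : (-1 - q : ℤ) ≠ 0)
    have h2 := smul_right_injective V hq h1
    rw [show (-1 - ((q + 1 : ℕ) : ℤ)) = -1 - q - 1 by push_cast; ring]
    exact h2.symm

/-- Locality on the vacuum, phrased as a defect with zero iterate so that the recursion extends it
from `n = L` to all `n ≥ L`. -/
theorem exists_prodSum_vacProd_comm (a b : V) : ∃ L : ℤ, ∀ m n k : ℤ, L ≤ n →
    borcherdsDefect 0 0 (A.vacProd a b) (A.vacProd b a) m n k = 0 := by
  obtain ⟨L, hL⟩ := A.locality a b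
  have hrec := borcherdsDefect_succ (g := 0) (L := 0) (fun _ _ _ => rfl) (A.vacProd_eq_zero a b)
    (A.vacProd_eq_zero b a) 0
  have hbase : ∀ m k : ℤ,
      borcherdsDefect 0 0 (A.vacProd a b) (A.vacProd b a) m L k = 0 := by
    intro m k
    have h := LinearMap.congr_fun (hL m k) A.vac
    simp only [LinearMap.sum_apply, LinearMap.smul_apply, LinearMap.sub_apply,
      Module.End.mul_apply, smul_sub, sum_sub_distrib, LinearMap.zero_apply] at h
    have hc : ∀ i : ℕ, L + 1 ≤ i → cchoose ((L : ℤ) : ℚ) i = 0 := fun i hi => by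
      rw [Int.cast_natCast, cchoose_natCast, Nat.choose_eq_zero_of_lt (by omega), Nat.cast_zero]
    rw [borcherdsDefect, iterSum_eq_zero (g := 0) (L := L) (fun _ _ _ => rfl) _ le_rfl, prodSum, prodSum,
      finsum_nat_eq_sum_range (K := L + 1) fun i hi => by rw [hc i hi, mul_zero, zero_smul],
      finsum_nat_eq_sum_range (K := L + 1) fun i hi => by rw [hc i hi, mul_zero, zero_smul],
      -- Locality expands both products in the same order, whereas the reversed product expands `(w
      -- - z)^L`; reflecting `i` to `L - i` produces the sign `(-1)^L`.
      ← sum_range_reflect (n := L + 1) (f := fun i : ℕ => ((-1) ^ i * cchoose (L : ℤ) i) •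
        A.vacProd b a (k + L - i) (m + i)), smul_sum, zero_sub, neg_add_eq_zero]
    simp only [Int.cast_natCast, cchoose_natCast]
    refine (sub_eq_zero.1 h).trans (sum_congr rfl fun i hi => ?_)
    have hi' : i ≤ L := by simp at hi; omega
    rw [show L + 1 - 1 - i = L - i by omega, Nat.choose_symm hi', smul_smul, Nat.cast_sub hi',
      show k + L - ((L : ℤ) - i) = k + i by ring, show m + ((L : ℤ) - i) = m + L - i by ring,
      ← mul_assoc, zpow_natCast]
    congr 2
    obtain ⟨c, rfl⟩ := Nat.exists_eq_add_of_le hi'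
    rw [Nat.add_sub_cancel_left, pow_add, mul_assoc, neg_one_pow_mul_neg_one_pow, mul_one]
  refine ⟨L, fun m n k hn => ?_⟩
  obtain ⟨c, rfl⟩ := Int.le.dest hn
  clear hn
  induction c generalizing m k with
  | zero => simpa using hbase m k
  | succ c ih =>
    have := hrec m (L + c) k
    rw [ih, ih, sub_zero] at this
    rw [← this]; congr 1

/-- At `m = 0` the reversed product vanishes and the iterate has a single term, leaving
`vacMode_ncoeff`; for large `n` the iterate vanishes and locality remains. -/
theorem borcherdsDefect_vac (a b : V) (m n k : ℤ) :
    borcherdsDefect 0 (A.vacIter a b) (A.vacProd a b) (A.vacProd b a) m n k = 0 := by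
  obtain ⟨L, hL⟩ := A.exists_prodSum_vacProd_comm a b
  obtain ⟨L', hL'⟩ := A.exists_ncoeff_eq_zero a b
  have hg : ∀ n q, (L' : ℤ) ≤ n → A.vacIter a b n q = 0 := fun n q hn => by
    rw [vacIter, hL' n hn, map_zero]
  refine eq_zero_of_recursion' (borcherdsDefect_succ hg (A.vacProd_eq_zero a b)
    (A.vacProd_eq_zero b a) 0) (m₀ := 0) (n₀ := max L L') (fun n k => ?_) (fun m n k hn => ?_) m n k
  · rw [borcherdsDefect, prodSum_eq_zero (A.vacProd_eq_zero b a) le_rfl, ← A.vacMode_ncoeff,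
      iterSum, finsum_nat_eq_sum_range (K := 1)]
    · simp [vacIter, cchoose_zero]
    · intro i hi
      obtain ⟨i, rfl⟩ := Nat.exists_eq_add_of_le' hi
      simp [cchoose_zero_succ]
  · have h := hL m n k (le_trans (le_max_left _ _) hn)
    rw [borcherdsDefect, iterSum_eq_zero (g := 0) (L := n) (fun _ _ _ => rfl) _ le_rfl] at h
    rw [borcherdsDefect, iterSum_eq_zero hg _ (le_trans (le_max_right _ _) hn), h]

/-- Take the vacuum identity for `(b, a)` at `m = -1`, `k = 0`: one product vanishes, the other is
`a_(n) b`, and the iterate is the series on the right. -/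
theorem skew_symmetry (a b : V) (n : ℤ) : ((A.Y a)[[n]]) b =
    -(-1 : ℂ) ^ n • ∑ᶠ i : ℕ, (-1 : ℂ) ^ i • A.vacMode (-1 - i) (((A.Y b)[[n + i]]) a) := by
  have h1 := A.borcherdsDefect_vac b a (-1) n 0
  have h2 : ((A.Y a)[[n]]) b = prodSum (A.vacProd a b) 0 n (-1) := by
    rw [← A.vacMode_ncoeff, vacMode_neg_one]
  have h4 : prodSum (A.vacProd b a) (-1) n 0 = 0 :=
    prodSum_eq_zero (A.vacProd_eq_zero b a) le_rfl
  rw [borcherdsDefect, h4, ← h2, sub_zero] at h1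
  have h5 : iterSum 0 (A.vacIter b a) (-1) n 0 =
      ∑ᶠ i : ℕ, (-1 : ℂ) ^ i • A.vacMode (-1 - i) (((A.Y b)[[n + i]]) a) := by
    refine finsum_congr fun i => ?_
    rw [show (0 : ℚ) + ((-1 : ℤ) : ℚ) = -1 by norm_num, cchoose_neg_one, vacIter, add_zero]
  rw [← h5, eq_neg_of_add_eq_zero_left h1, neg_smul_neg, smul_smul, ← zpow_add₀ (by norm_num),
    Even.neg_one_zpow ⟨n, rfl⟩, one_smul]

theorem T_eq (a : V) : A.T a = A.vacMode (-2) a := by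
  have := A.T_vacMode a (-1)
  rw [vacMode_neg_one] at this
  rw [this]; norm_num

end VertexAlgebra

end

/-! ### From formal series to sums over modes -/

noncomputable section

open Finset
open scoped VertexOperator

theorem finsum_eq_finsum_comp_of_injective {ι κ X : Type*} [AddCommMonoid X] {φ : ι → κ}
    (hφ : Function.Injective φ) {F : κ → X} (h : ∀ e, e ∉ Set.range φ → F e = 0) :
    ∑ᶠ e, F e = ∑ᶠ i, F (φ i) := by
  rw [← finsum_mem_range hφ, ← finsum_mem_univ]
  refine finsum_mem_inter_support_eq' _ _ _ fun e he => ?_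
  simp only [Set.mem_univ, true_iff]
  by_contra hc
  exact he (h e hc)

namespace Series₂

theorem binomial_apply (c : ℂ) (s : ℚ) (i : ℕ) :
    binomial c s (s - i) i = cchoose s i * c ^ i := by
  simp [binomial, cchoose]

theorem binomial_eq_zero {c : ℂ} {s α β : ℚ} (h : ∀ i : ℕ, β = i → α ≠ s - i) :
    binomial c s α β = 0 := by
  rw [binomial, if_neg]
  rintro ⟨h1, h2⟩
  exact h _ h1 (by rw [← h1]; linarith)

variable {X : Type*} [AddCommGroup X] [Module ℂ X]

theorem mul_apply_eq_finsum {f : Series₂ ℂ} {φ : ℕ → ℚ × ℚ} (hφ : Function.Injective φ)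
    (hf : ∀ e, e ∉ Set.range φ → f e.1 e.2 = 0) (S : Series₂ X) (α β : ℚ) :
    mul f S α β = ∑ᶠ i, f (φ i).1 (φ i).2 • S (α - (φ i).1) (β - (φ i).2) := by
  refine finsum_eq_finsum_comp_of_injective hφ fun e he => ?_
  rw [hf e he, zero_smul]

/-- Each `f d` is supported on a sequence `φ d`, along which `S` is eventually zero; this finiteness
justifies exchanging the sum over `d` with the `finsum`. -/
theorem sum_mul_apply_eq {ι : Type*} (t : Finset ι) (c : ι → ℂ) (f : ι → Series₂ ℂ)
    (φ : ι → ℕ → ℚ × ℚ) (hφ : ∀ d, Function.Injective (φ d))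
    (hf : ∀ d e, e ∉ Set.range (φ d) → f d e.1 e.2 = 0) (S : Series₂ X) (α β : ℚ)
    (hS : ∀ d, ∃ K : ℕ, ∀ i, K ≤ i → S (α - (φ d i).1) (β - (φ d i).2) = 0) :
    mul (fun x y => ∑ d ∈ t, c d * f d x y) S α β =
      ∑ d ∈ t, c d • ∑ᶠ i, f d (φ d i).1 (φ d i).2 • S (α - (φ d i).1) (β - (φ d i).2) := by
  simp only [mul, sum_smul, mul_smul]
  rw [finsum_sum_comm]
  · refine sum_congr rfl fun d _ => ?_
    rw [← smul_finsum]
    congr 1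
    exact mul_apply_eq_finsum (hφ d) (hf d) S α β
  · intro d _
    obtain ⟨K, hK⟩ := hS d
    refine ((Set.finite_Iio K).image (φ d)).subset fun e he => ?_
    by_contra hc
    refine he ?_
    by_cases h : e ∈ Set.range (φ d)
    · obtain ⟨i, rfl⟩ := h
      have hi : K ≤ i := by
        by_contra hi
        exact hc ⟨i, by simpa using hi, rfl⟩
      simp only [hK i hi, smul_zero]
    · simp only [hf d e h, zero_smul, smul_zero]

theorem mul_binomial_apply (c : ℂ) (s : ℚ) (S : Series₂ X) (α β : ℚ) :
    mul (binomial c s) S α β =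
      ∑ᶠ i : ℕ, (cchoose s i * c ^ i) • S (α - (s - i)) (β - i) := by
  rw [mul_apply_eq_finsum (φ := fun i : ℕ => (s - i, (i : ℚ)))]
  · simp only [binomial_apply]
  · intro i j h
    simpa using h
  · rintro ⟨x, y⟩ he
    refine binomial_eq_zero fun i hi hx => he ⟨i, by simp_all⟩

theorem mul_binomial_swap_apply (c : ℂ) (s : ℚ) (S : Series₂ X) (α β : ℚ) :
    mul (binomial c s).swap S α β =
      ∑ᶠ i : ℕ, (cchoose s i * c ^ i) • S (α - i) (β - (s - i)) := by
  rw [mul_apply_eq_finsum (φ := fun i : ℕ => ((i : ℚ), s - i))]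
  · simp only [swap, binomial_apply]
  · intro i j h
    simpa using h
  · rintro ⟨x, y⟩ he
    refine binomial_eq_zero fun i hi hx => he ⟨i, by simp_all⟩

end Series₂

namespace VertexAlgebra

variable {V : Type*} [AddCommGroup V] [Module ℂ V] (A : VertexAlgebra V) {N : ℕ}
  {M : Type*} [AddCommGroup M] [Module ℂ M] (Y : V →ₗ[ℂ] TwistedField N M)

theorem mode_intCast (a : V) (n : ℤ) : A.mode a n = (A.Y a)[[n]] := by simp [mode]

theorem mode_eq_zero (a : V) {x : ℚ} (hx : ∀ n : ℤ, x ≠ n) : A.mode a x = 0 := by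
  rw [mode, if_neg (hx _)]

theorem tmode_add (a b : V) (x : ℚ) : tmode Y (a + b) x = tmode Y a x + tmode Y b x := by
  simp [tmode]

theorem tmode_smul (c : ℂ) (a : V) (x : ℚ) : tmode Y (c • a) x = c • tmode Y a x := by
  simp [tmode]

theorem tmode_zero (x : ℚ) : tmode Y 0 x = 0 := by simp [tmode]

theorem exists_tmode_eq_zero (a : V) (v : M) (r : ℚ) :
    ∃ B : ℤ, ∀ q : ℤ, B ≤ q → tmode Y a (r + q) v = 0 := by
  obtain ⟨B, hB⟩ := (Y a).2.2 v
  refine ⟨⌈B - r⌉, fun q hq => hB _ ?_⟩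
  have := Int.ceil_le.1 hq
  linarith

/-- The coefficients of `Y^M(Y(a, t) b, w) v`, with the exponents of `w` in a coset of `ℤ`. -/
def twIter (a b : V) (v : M) (x : ℚ) (n q : ℤ) : M := tmode Y (((A.Y a)[[n]]) b) (x + q) v

/-- The coefficients of `Y^M(a, z) Y^M(b, w) v`, with exponents in cosets of `ℤ`. -/
def twProd (a b : V) (v : M) (s r : ℚ) (p q : ℤ) : M := tmode Y a (s + p) (tmode Y b (r + q) v)

/-- The failure of the twisted Borcherds identity for monomials. -/
def twDefect (a b : V) (v : M) (s r : ℚ) : ℤ → ℤ → ℤ → M :=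
  borcherdsDefect s (twIter A Y a b v (s + r)) (twProd Y a b v s r) (twProd Y b a v r s)

theorem exists_twIter_eq_zero (a b : V) : ∃ L : ℤ, ∀ (v : M) (x : ℚ) (n q : ℤ), L ≤ n →
    twIter A Y a b v x n q = 0 := by
  obtain ⟨L, hL⟩ := A.exists_ncoeff_eq_zero a b
  exact ⟨L, fun v x n q hn => by rw [twIter, hL n hn, tmode_zero]; rfl⟩

theorem exists_twProd_eq_zero (a b : V) (v : M) (s r : ℚ) : ∃ B : ℤ, ∀ p q : ℤ, B ≤ q →
    twProd Y a b v s r p q = 0 := by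
  obtain ⟨B, hB⟩ := exists_tmode_eq_zero Y b v r
  exact ⟨B, fun p q hq => by rw [twProd, hB q hq, map_zero]⟩

theorem twDefect_succ (a b : V) (v : M) (s r : ℚ) (m n k : ℤ) :
    twDefect A Y a b v s r m (n + 1) k =
      twDefect A Y a b v s r (m + 1) n k - twDefect A Y a b v s r m n (k + 1) := by
  obtain ⟨L, hL⟩ := exists_twIter_eq_zero A Y a b
  obtain ⟨B, hB⟩ := exists_twProd_eq_zero Y a b v s r
  obtain ⟨B', hB'⟩ := exists_twProd_eq_zero Y b a v r s
  exact borcherdsDefect_succ (hL v _) hB hB' s m n k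

theorem res_mul_expandWT (F : RatFun) (s : ℚ) (a b : V) (v : M) (β : ℚ) :
    (Series₂.mul (F.expandWT s) (iterSeries A Y a b v)).res β =
      ∑ d ∈ F.P.support, F.P.coeff d • iterSum s (twIter A Y a b v (s + (-β - 1)))
        ((d 0 : ℤ) - F.p) (-F.n) ((d 1 : ℤ) - F.q) := by
  have hcoef : ∀ (d : Fin 2 →₀ ℕ) (i : ℕ), iterSeries A Y a b v (-1 - (i - F.n))
      (β - (s + d 0 - F.p - i + (d 1 - F.q))) = twIter A Y a b v (s + (-β - 1)) (-F.n + i)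
        ((d 0 : ℤ) - F.p + ((d 1 : ℤ) - F.q) - i) := fun d i => by
    rw [iterSeries, twIter, ← mode_intCast]
    congr 3
    · congr 1; push_cast; ring
    · push_cast; ring
  obtain ⟨L, hL⟩ := exists_twIter_eq_zero A Y a b
  rw [Series₂.res]
  refine (Series₂.sum_mul_apply_eq F.P.support (fun d => F.P.coeff d)
    (fun d x y => Series₂.binomial 1 (s + d 0 - F.p) (y - (d 1 - F.q)) (x + F.n))
    (fun d i => ((i : ℚ) - F.n, s + d 0 - F.p - i + (d 1 - F.q))) ?_ ?_ _ _ _ ?_).trans ?_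
  · intro d i j h
    simpa using congrArg Prod.fst h
  · rintro d ⟨x, y⟩ he
    refine Series₂.binomial_eq_zero fun i hi hx => he ⟨i, ?_⟩
    simp only [Prod.mk.injEq] at *
    constructor <;> linarith
  · intro d
    refine ⟨(L + F.n).toNat, fun i hi => ?_⟩
    rw [hcoef, hL _ _ _ _ (by omega)]
  · refine sum_congr rfl fun d _ => ?_
    congr 1
    refine finsum_congr fun i => ?_
    rw [hcoef]
    congr 1
    simp only [add_sub_cancel_right, sub_add_cancel]
    rw [Series₂.binomial_apply]
    push_cast
    rw [one_pow, mul_one, add_sub_assoc]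

theorem res_mul_expandZW (F : RatFun) (s : ℚ) (a b : V) (v : M) (β : ℚ) :
    (Series₂.mul (F.expandZW s) (prodSeries Y a b v)).res β =
      ∑ d ∈ F.P.support, F.P.coeff d • prodSum (twProd Y a b v s (-β - 1))
        ((d 0 : ℤ) - F.p) (-F.n) ((d 1 : ℤ) - F.q) := by
  have hcoef : ∀ (d : Fin 2 →₀ ℕ) (i : ℕ), prodSeries Y a b v
      (-1 - (s + d 0 - F.p + (-F.n - i))) (β - (i + (d 1 - F.q))) =
      twProd Y a b v s (-β - 1) ((d 0 : ℤ) - F.p + (-F.n) - i) ((d 1 : ℤ) - F.q + i) :=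
    fun d i => by
      rw [prodSeries, twProd]
      congr 2
      · push_cast; ring
      · congr 1; push_cast; ring
  obtain ⟨B, hB⟩ := exists_twProd_eq_zero Y a b v s (-β - 1)
  rw [Series₂.res]
  refine (Series₂.sum_mul_apply_eq F.P.support (fun d => F.P.coeff d)
    (fun d x y => Series₂.binomial (-1) (-(F.n : ℚ)) (x - (s + d 0 - F.p)) (y - (d 1 - F.q)))
    (fun d i => (s + d 0 - F.p + (-F.n - i), (i : ℚ) + (d 1 - F.q))) ?_ ?_ _ _ _ ?_).trans ?_
  · intro d i j h
    simpa using congrArg Prod.fst h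
  · rintro d ⟨x, y⟩ he
    refine Series₂.binomial_eq_zero fun i hi hx => he ⟨i, ?_⟩
    simp only [Prod.mk.injEq] at *
    constructor <;> linarith
  · intro d
    refine ⟨(B - ((d 1 : ℤ) - F.q)).toNat, fun i hi => ?_⟩
    rw [hcoef, hB _ _ (by omega)]
  · refine sum_congr rfl fun d _ => ?_
    congr 1
    refine finsum_congr fun i => ?_
    rw [hcoef]
    congr 1
    simp only [add_sub_cancel_left, add_sub_cancel_right]
    rw [Series₂.binomial_apply]
    push_cast
    rw [mul_comm]

theorem res_mul_expandWZ (F : RatFun) (s : ℚ) (a b : V) (v : M) (β : ℚ) :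
    (Series₂.mul (F.expandWZ s) (prodSeries Y b a v).swap).res β =
      ∑ d ∈ F.P.support, F.P.coeff d • (-1 : ℂ) ^ (-F.n : ℤ) •
        prodSum (twProd Y b a v (-β - 1) s) ((d 1 : ℤ) - F.q) (-F.n) ((d 0 : ℤ) - F.p) := by
  have hcoef : ∀ (d : Fin 2 →₀ ℕ) (i : ℕ), (prodSeries Y b a v).swap
      (-1 - (i + (s + d 0 - F.p))) (β - ((d 1 - F.q) + (-F.n - i))) =
      twProd Y b a v (-β - 1) s ((d 1 : ℤ) - F.q + (-F.n) - i) ((d 0 : ℤ) - F.p + i) :=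
    fun d i => by
      rw [Series₂.swap, prodSeries, twProd]
      congr 2
      · push_cast; ring
      · congr 1; push_cast; ring
  obtain ⟨B, hB⟩ := exists_twProd_eq_zero Y b a v (-β - 1) s
  rw [Series₂.res]
  refine (Series₂.sum_mul_apply_eq F.P.support (fun d => F.P.coeff d)
    (fun d x y => (-1) ^ F.n *
      Series₂.binomial (-1) (-(F.n : ℚ)) (y - (d 1 - F.q)) (x - (s + d 0 - F.p)))
    (fun d i => ((i : ℚ) + (s + d 0 - F.p), (d 1 - F.q) + (-F.n - i))) ?_ ?_ _ _ _ ?_).trans ?_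
  · intro d i j h
    simpa using congrArg Prod.fst h
  · rintro d ⟨x, y⟩ he
    refine mul_eq_zero_of_right _ (Series₂.binomial_eq_zero fun i hi hx => he ⟨i, ?_⟩)
    simp only [Prod.mk.injEq] at *
    constructor <;> linarith
  · intro d
    refine ⟨(B - ((d 0 : ℤ) - F.p)).toNat, fun i hi => ?_⟩
    rw [hcoef, hB _ _ (by omega)]
  · refine sum_congr rfl fun d _ => ?_
    congr 1
    rw [prodSum, smul_finsum]
    refine finsum_congr fun i => ?_
    rw [hcoef, smul_smul]
    congr 1
    simp only [add_sub_cancel_left, add_sub_cancel_right]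
    rw [Series₂.binomial_apply, zpow_neg, zpow_natCast, ← inv_pow]
    push_cast
    norm_num
    ring

/-- Both sides of the twisted Borcherds identity, expanded over the monomials of `F`. -/
theorem borcherds_monomial_expansion (F : RatFun) (s : ℚ) (a b : V) (v : M) (β : ℚ) :
    (Series₂.mul (F.expandWT s) (iterSeries A Y a b v)).res β -
      ((Series₂.mul (F.expandZW s) (prodSeries Y a b v)).res β -
      (Series₂.mul (F.expandWZ s) (prodSeries Y b a v).swap).res β) =
    ∑ d ∈ F.P.support, F.P.coeff d •
      twDefect A Y a b v s (-β - 1) ((d 0 : ℤ) - F.p) (-F.n) ((d 1 : ℤ) - F.q) := by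
  rw [res_mul_expandWT, res_mul_expandZW, res_mul_expandWZ, ← sum_sub_distrib, ← sum_sub_distrib]
  refine sum_congr rfl fun d _ => ?_
  rw [twDefect, borcherdsDefect, smul_add, smul_sub]
  abel

theorem satisfiesTwistedBorcherds_iff (σ : V ≃ₗ[ℂ] V) :
    SatisfiesTwistedBorcherds A σ Y ↔ ∀ j : ℕ, j < N → ∀ a : V, InEigenspace σ N j a →
      ∀ (b : V) (v : M) (r : ℚ) (m n k : ℤ), twDefect A Y a b v ((j : ℚ) / N) r m n k = 0 := by
  constructor
  · intro h j hj a ha b v r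
    -- A `RatFun` has `(z - w)` only in its denominator, so a monomial numerator reaches exponents
    -- `-n` directly; the recursion then supplies the positive ones.
    have hneg : ∀ (n : ℕ) (m k : ℤ), twDefect A Y a b v ((j : ℚ) / N) r m (-n) k = 0 := by
      intro n m k
      have h1 := h j hj a ha b ⟨MvPolynomial.monomial
        (Finsupp.single 0 m.toNat + Finsupp.single 1 k.toNat) 1, (-m).toNat, (-k).toNat, n⟩ v
        (-r - 1)
      rw [← sub_eq_zero, borcherds_monomial_expansion] at h1
      have hs : (MvPolynomial.monomial (Finsupp.single (0 : Fin 2) m.toNat +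
          Finsupp.single 1 k.toNat) (1 : ℂ)).support = {Finsupp.single (0 : Fin 2) m.toNat +
          Finsupp.single 1 k.toNat} := by
        classical
        rw [MvPolynomial.support_monomial, if_neg one_ne_zero]
      rw [hs, sum_singleton] at h1
      simp only [MvPolynomial.coeff_monomial, if_true, one_smul, Finsupp.add_apply,
        Finsupp.single_apply] at h1
      norm_num at h1
      exact h1
    have hnat : ∀ (n : ℕ) (m k : ℤ), twDefect A Y a b v ((j : ℚ) / N) r m n k = 0 := by
      intro n
      induction n with
      | zero => simpa using hneg 0
      | succ n ih =>
        intro m k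
        rw [Nat.cast_succ, twDefect_succ, ih, ih, sub_zero]
    intro m n k
    rcases Int.eq_nat_or_neg n with ⟨n, rfl | rfl⟩
    · exact hnat n m k
    · exact hneg n m k
  · intro h j hj a ha b F v β
    rw [← sub_eq_zero, borcherds_monomial_expansion]
    exact sum_eq_zero fun d _ => by rw [h j hj a ha, smul_zero]

end VertexAlgebra

end

/-! ### Eigenspaces, associativity in modes, and translation covariance -/

noncomputable section

open Finset
open scoped VertexOperator

namespace VertexAlgebra

variable {V : Type*} [AddCommGroup V] [Module ℂ V] (A : VertexAlgebra V) {σ : V ≃ₗ[ℂ] V} {N : ℕ}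
  {M : Type*} [AddCommGroup M] [Module ℂ M] {Y : V →ₗ[ℂ] TwistedField N M}

/-- A nonzero mode forces `exp(-2πi j/N) = exp(-2πi x)`. -/
theorem tmode_eq_zero_of_eigenspace (hY : IsEquivariant σ Y) {j : ℕ} {a : V}
    (ha : InEigenspace σ N j a) {x : ℚ} (hx : ∀ p : ℤ, x ≠ (j : ℚ) / N + p) :
    tmode Y a x = 0 := by
  have h := hY a x
  rw [ha, tmode_smul] at h
  by_contra hne
  have h1 := smul_left_injective ℂ hne h
  rw [Complex.exp_eq_exp_iff_exists_int] at h1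
  obtain ⟨n, hn⟩ := h1
  refine hx n ?_
  have hpi : (2 * Real.pi * Complex.I : ℂ) ≠ 0 := Complex.two_pi_I_ne_zero
  have h2 : (2 * Real.pi * Complex.I : ℂ) * x = (2 * Real.pi * Complex.I) * ((j : ℂ) / N + n) := by
    linear_combination hn
  have h3 := mul_left_cancel₀ hpi h2
  have h4 : (x : ℂ) = (((j : ℚ) / N + n : ℚ) : ℂ) := by push_cast; exact h3
  exact Rat.cast_injective h4

theorem InEigenspace.ncoeff {A : VertexAlgebra V} (hσ : A.IsAutomorphism σ) {j l : ℕ} {a b : V}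
    (ha : InEigenspace σ N j a) (hb : InEigenspace σ N l b) (n : ℤ) :
    InEigenspace σ N (j + l) (((A.Y a)[[n]]) b) := by
  rw [InEigenspace, hσ.map_mode, ha, hb, map_smul, map_smul, map_smul, Pi.smul_apply,
    LinearMap.smul_apply, smul_smul, ← Complex.exp_add]
  congr 2
  push_cast
  ring

theorem InEigenspace.vac {A : VertexAlgebra V} (hσ : A.IsAutomorphism σ) :
    InEigenspace σ N 0 A.vac := by
  simp [InEigenspace, hσ.map_vac]

/-- A property that is stable under sums and holds on the eigenspaces of a finite-order
automorphism holds everywhere. -/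
theorem eigenspace_induction (hN : 0 < N) (hord : σ ^ N = 1) {P : V → Prop}
    (hadd : ∀ a b, P a → P b → P (a + b))
    (heig : ∀ j < N, ∀ a, InEigenspace σ N j a → P a) (a : V) : P a := by
  set ζ : ℂ := Complex.exp (2 * Real.pi * Complex.I / N)
  have hζ : IsPrimitiveRoot ζ N := Complex.isPrimitiveRoot_exp N hN.ne'
  -- Up to the factor `1/N`, `c j` is the projection of `a` to the `j`-th eigenspace; orthogonality
  -- of roots of unity recovers `a` from these.
  set c : ℕ → V := fun j => ∑ k ∈ range N, (ζ ^ j) ^ k • (σ ^ k) a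
  have hc : ∀ j, InEigenspace σ N j (c j) := by
    intro j
    have h1 : ζ ^ j • σ (c j) = c j := by
      have h2 := sum_range_succ (fun k => (ζ ^ j) ^ k • (σ ^ k) a) N
      have h3 := sum_range_succ' (fun k => (ζ ^ j) ^ k • (σ ^ k) a) N
      rw [h2, hord, ← pow_mul, mul_comm, pow_mul, hζ.pow_eq_one, one_pow, pow_zero, pow_zero] at h3
      have h4 := add_right_cancel h3
      rw [show c j = ∑ k ∈ range N, (ζ ^ j) ^ k • (σ ^ k) a from rfl, map_sum, smul_sum, h4]
      refine sum_congr rfl fun k _ => ?_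
      rw [map_smul, smul_smul, pow_succ' (ζ ^ j), pow_succ' σ]
      rfl
    have h5 : Complex.exp (-(2 * Real.pi * Complex.I * j / N)) * ζ ^ j = 1 := by
      rw [← Complex.exp_nat_mul, ← Complex.exp_add, ← Complex.exp_zero]
      congr 1
      ring
    rw [InEigenspace]
    nth_rewrite 2 [← h1]
    rw [smul_smul, h5, one_smul]
  have hsum : a = ∑ j ∈ range N, (N : ℂ)⁻¹ • c j := by
    have h1 : ∀ k ∈ range N, k ≠ 0 → (∑ j ∈ range N, (ζ ^ j) ^ k) • (σ ^ k) a = 0 := by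
      intro k hk hk0
      have h2 := mul_geom_sum (ζ ^ k) N
      rw [← pow_mul ζ k N, mul_comm k N, pow_mul, hζ.pow_eq_one, one_pow, sub_self] at h2
      have h3 := hζ.pow_ne_one_of_pos_of_lt hk0 (mem_range.1 hk)
      have h4 := (mul_eq_zero.1 h2).resolve_left (sub_ne_zero.2 h3)
      simp only [← pow_mul] at h4 ⊢
      simp only [mul_comm _ k, h4, zero_smul]
    rw [← smul_sum, sum_comm]
    simp only [← sum_smul]
    rw [sum_eq_single 0 h1 fun h => absurd (mem_range.2 hN) h]
    have hN' : (N : ℂ) ≠ 0 := by exact_mod_cast hN.ne'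
    simp [smul_smul, hN']
  rw [hsum]
  refine sum_induction _ P hadd (heig 0 hN 0 (by simp [InEigenspace])) fun j hj => ?_
  refine heig j (mem_range.1 hj) _ ?_
  rw [InEigenspace, map_smul, hc j, smul_comm]

/-- The series `Y^M(a, z + w) Y^M(b, w) v` multiplied by `(z + w) ^ s`. -/
theorem mul_shiftedProdSeries_apply (s : ℚ) (a b : V) (v : M) (α β : ℚ) :
    Series₂.mul (Series₂.binomial 1 s) (shiftedProdSeries Y a b v) α β =
      ∑ᶠ p : ℕ, cchoose (α + p) p •
        tmode Y a (-α + s - 1 - p) (tmode Y b (-β - 1 + p) v) := by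
  have hsh : ∀ α β : ℚ, shiftedProdSeries Y a b v α β =
      ∑ᶠ l : ℕ, cchoose (α + l) l • tmode Y a (-α - 1 - l) (tmode Y b (-β - 1 + l) v) := by
    intro α β
    rw [shiftedProdSeries, finsum_eq_finsum_comp_of_injective
      (φ := fun l : ℕ => (-α - 1 - l, -β - 1 + (l : ℚ)))]
    · refine finsum_congr fun l => ?_
      have := Series₂.binomial_apply 1 (α + l) l
      rw [one_pow, mul_one] at this
      rw [← this]
      congr 2 <;> ring
    · intro i j h
      simpa using congrArg Prod.fst h
    · rintro ⟨x, y⟩ he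
      rw [Series₂.binomial_eq_zero, zero_smul]
      intro i hi hx
      refine he ⟨i, ?_⟩
      simp only [Prod.mk.injEq] at *
      constructor <;> linarith
  obtain ⟨B, hB⟩ := exists_tmode_eq_zero Y b v (-β - 1)
  set K := B.toNat
  have hz : ∀ p : ℕ, K ≤ p → tmode Y b (-β - 1 + p) v = 0 := fun p hp => by
    simpa using hB p (by omega)
  rw [Series₂.mul_binomial_apply, finsum_nat_eq_sum_range (K := K),
    finsum_nat_eq_sum_range (K := K)]
  · have h1 : ∀ i : ℕ, (cchoose s i * 1 ^ i) • shiftedProdSeries Y a b v (α - (s - i)) (β - i) =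
        ∑ l ∈ range K, (cchoose s i * cchoose (α - s + ((i + l : ℕ) : ℚ)) l) •
          tmode Y a (-α + s - 1 - ((i + l : ℕ) : ℚ))
            (tmode Y b (-β - 1 + ((i + l : ℕ) : ℚ)) v) := by
      intro i
      rw [hsh, finsum_nat_eq_sum_range (K := K), smul_sum]
      · refine sum_congr rfl fun l _ => ?_
        rw [smul_smul, one_pow, mul_one]
        push_cast
        rw [show α - (s - i) + (l : ℚ) = α - s + (i + l) by ring,
          show -(α - (s - i)) - 1 - (l : ℚ) = -α + s - 1 - (i + l) by ring,
          show -(β - i) - 1 + (l : ℚ) = -β - 1 + (i + l) by ring]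
      · intro l hl
        rw [show -(β - i) - 1 + (l : ℚ) = -β - 1 + ((i + l : ℕ) : ℚ) by push_cast; ring,
          hz _ (by omega), map_zero, smul_zero]
    simp only [h1]
    rw [sum_range_sum_range_eq_sum_antidiagonal]
    · refine sum_congr rfl fun p _ => ?_
      -- Vandermonde: multiplying `(z + w)^s` by the binomial expansion from `Y^M(a, z + w)` leaves
      -- a single binomial series.
      rw [show α + (p : ℚ) = s + (α - s + p) by ring, cchoose_add, sum_smul]
      refine sum_congr rfl fun ij hij => ?_
      rw [mem_antidiagonal.1 hij]
    · intro i l hil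
      rw [hz _ hil, map_zero, smul_zero]
  · intro p hp
    rw [hz p hp, map_zero, smul_zero]
  · intro i hi
    rw [hsh, finsum_nat_eq_sum_range (K := 0), sum_range_zero, smul_zero]
    intro l _
    rw [show -(β - i) - 1 + (l : ℚ) = -β - 1 + ((i + l : ℕ) : ℚ) by push_cast; ring,
      hz _ (by omega), map_zero, smul_zero]

/-- The coefficient of `z^(-n-1) w^(-r-k-1)` on each side is a residue sum with `m` fixed.
Non-integral powers of `z` contribute zero on both sides, on the right because `a` is an
eigenvector. -/
theorem assocIdentity_iff (hY : IsEquivariant σ Y) {j : ℕ} {a : V}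
    (ha : InEigenspace σ N j a) (b : V) (v : M) (m : ℤ) :
    AssocIdentity A Y ((m : ℚ) + (j : ℚ) / N) a b v ↔ ∀ (r : ℚ) (n k : ℤ),
      iterSum ((j : ℚ) / N) (twIter A Y a b v ((j : ℚ) / N + r)) m n k =
        prodSum (twProd Y a b v ((j : ℚ) / N) r) m n k := by
  set s : ℚ := (j : ℚ) / N
  have hL : ∀ (r : ℚ) (n k : ℤ), Series₂.mul (Series₂.binomial 1 (m + s)).swap
      (iterSeries A Y a b v) (-n - 1) (-r - k - 1) =
        iterSum s (twIter A Y a b v (s + r)) m n k := by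
    intro r n k
    rw [Series₂.mul_binomial_swap_apply]
    refine finsum_congr fun i => ?_
    rw [one_pow, mul_one, add_comm (m : ℚ) s, iterSeries, twIter, ← mode_intCast]
    congr 4
    · congr 1; push_cast; ring
    · push_cast; ring
  have hR : ∀ (r : ℚ) (n k : ℤ), Series₂.mul (Series₂.binomial 1 (m + s))
      (shiftedProdSeries Y a b v) (-n - 1) (-r - k - 1) =
        prodSum (twProd Y a b v s r) m n k := by
    intro r n k
    rw [mul_shiftedProdSeries_apply]
    refine finsum_congr fun i => ?_
    rw [show (-n - 1 + i : ℚ) = -(n + 1 - i) by ring, cchoose_neg, twProd]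
    rw [show n + 1 - (i : ℚ) + i - 1 = n by ring,
      show -(-(n : ℚ) - 1) + (m + s) - 1 - i = s + (m + n - i : ℤ) by push_cast; ring,
      show -(-r - (k : ℚ) - 1) - 1 + i = r + (k + i : ℤ) by push_cast; ring]
  constructor
  · intro h r n k
    rw [← hL, ← hR, h]
  · intro h
    funext α β
    by_cases hα : ∃ n : ℤ, α = n
    · obtain ⟨n, rfl⟩ := hα
      -- The coset parameter `r` absorbs the whole exponent of `w`, so `k = 0` suffices.
      have := h (-β - 1) (-n - 1) 0
      rw [← hL, ← hR] at this
      push_cast at this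
      ring_nf at this ⊢
      exact this
    · push Not at hα
      rw [Series₂.mul_binomial_swap_apply, mul_shiftedProdSeries_apply,
        finsum_nat_eq_sum_range (K := 0), finsum_nat_eq_sum_range (K := 0), sum_range_zero,
        sum_range_zero]
      · intro p _
        rw [tmode_eq_zero_of_eigenspace hY ha, LinearMap.zero_apply, smul_zero]
        intro q hq
        refine hα (m - 1 - p - q) ?_
        push_cast
        linarith
      · intro i _
        dsimp only [iterSeries]
        rw [mode_eq_zero, LinearMap.zero_apply, tmode_zero, LinearMap.zero_apply,
          smul_zero]
        intro q hq
        refine hα (-q - 1 + i) ?_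
        push_cast
        linarith

theorem tmode_T (hσ : A.IsAutomorphism σ) (hN : 0 < N) (hord : σ ^ N = 1)
    (hY : IsEquivariant σ Y) (hv : SatisfiesVacuum A Y) (hA : SatisfiesAssociativity A σ Y)
    (a : V) (x : ℚ) : tmode Y (A.T a) x = (-(x : ℂ)) • tmode Y a (x - 1) := by
  refine eigenspace_induction (P := fun a => tmode Y (A.T a) x = (-(x : ℂ)) • tmode Y a (x - 1))
    hN hord (fun a b ha hb => ?_) (fun j hj a ha => ?_) a
  · rw [map_add, tmode_add, tmode_add, ha, hb, smul_add]
  have hTa : InEigenspace σ N j (A.T a) := by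
    rw [T_eq]
    exact ha.ncoeff hσ (InEigenspace.vac hσ) (-2)
  by_cases hx : ∃ p : ℤ, x = (j : ℚ) / N + p
  swap
  · push Not at hx
    rw [tmode_eq_zero_of_eigenspace hY hTa hx, tmode_eq_zero_of_eigenspace hY ha, smul_zero]
    intro p hp
    refine hx (p + 1) ?_
    push_cast
    linarith
  obtain ⟨p, rfl⟩ := hx
  ext v
  obtain ⟨n₀, hn₀⟩ := hA j hj a ha A.vac v
  set n := max n₀ (p + 1).toNat
  -- With `k = -1 - l`, the vacuum mode `-1` occurs exactly at `i = l` on the product side, while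
  -- the iterate with `n = -2` has only the terms `a_(-2) vac = T a` and `a_(-1) vac = a`.
  obtain ⟨l, hl⟩ : ∃ l : ℕ, (n : ℤ) = p + 1 + l := ⟨(n - p - 1).toNat, by omega⟩
  have h := (assocIdentity_iff A hY ha A.vac v n).1 (hn₀ n (le_max_left _ _)) 0 (-2) (-1 - l)
  rw [iterSum, prodSum, finsum_nat_eq_sum_range (K := 2), finsum_eq_single _ l] at h
  · have hc : (-1 : ℂ) ^ l * cchoose (-2) l = l + 1 := by
      rw [cchoose_neg, ← mul_assoc, neg_one_pow_mul_neg_one_pow, one_mul,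
        show (2 : ℚ) + l - 1 = ((l + 1 : ℕ) : ℚ) by push_cast; ring, cchoose_natCast]
      simp
    rw [sum_range_succ, sum_range_one, cchoose_zero, cchoose_one, one_smul] at h
    have h1 : twIter A Y a A.vac v ((j : ℚ) / N + 0) (-2 + (0 : ℕ)) (n + (-1 - l) - (0 : ℕ)) =
        tmode Y (A.T a) ((j : ℚ) / N + p) v := by
      rw [T_eq, hl, twIter]
      congr 2
      push_cast
      ring
    have h2 : twIter A Y a A.vac v ((j : ℚ) / N + 0) (-2 + (1 : ℕ)) (n + (-1 - l) - (1 : ℕ)) =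
        tmode Y a ((j : ℚ) / N + p - 1) v := by
      rw [hl, twIter, show (-2 + (1 : ℕ) : ℤ) = -1 by norm_num, A.field_vac]
      congr 2
      push_cast
      ring
    have h3 : twProd Y a A.vac v ((j : ℚ) / N) 0 (n + -2 - l) (-1 - l + l) =
        tmode Y a ((j : ℚ) / N + p - 1) v := by
      rw [hl, twProd, hv, if_pos (by push_cast; ring)]
      simp only [Module.End.one_apply]
      congr 2
      push_cast
      ring
    rw [h1, h2, h3, show ((-2 : ℤ) : ℚ) = -2 by norm_num, hc, hl] at h
    rw [eq_sub_of_add_eq h, LinearMap.smul_apply]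
    push_cast
    module
  · intro i hi
    rw [twProd, hv, if_neg, LinearMap.zero_apply, map_zero, smul_zero]
    intro hc
    apply hi
    have : (-1 - l + i : ℤ) = -1 := by
      have : ((-1 - l + i : ℤ) : ℚ) = -1 := by linarith
      exact_mod_cast this
    omega
  · intro i hi
    rw [twIter, A.field_vac_nonneg _ _ (by omega), tmode_zero, LinearMap.zero_apply, smul_zero]

/-- Iterated translation covariance, since `vacMode (-1 - i) a` is `T^i a / i!`. -/
theorem tmode_vacMode (hσ : A.IsAutomorphism σ) (hN : 0 < N) (hord : σ ^ N = 1)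
    (hY : IsEquivariant σ Y) (hv : SatisfiesVacuum A Y) (hA : SatisfiesAssociativity A σ Y)
    (a : V) (i : ℕ) (x : ℚ) : tmode Y (A.vacMode (-1 - i) a) x =
      ((-1) ^ i * cchoose x i) • tmode Y a (x - i) := by
  induction i generalizing x with
  | zero => simp [vacMode_neg_one, cchoose_zero]
  | succ i ih =>
    have h1 := tmode_T A hσ hN hord hY hv hA (A.vacMode (-1 - i) a) x
    rw [T_vacMode, tmode_smul, ih, smul_smul] at h1
    have hi : (-((-1 - i : ℤ) : ℂ)) ≠ 0 := by
      rw [neg_ne_zero]; exact_mod_cast (by omega : (-1 - i : ℤ) ≠ 0)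
    refine smul_right_injective _ hi ?_
    dsimp only
    rw [show (-1 - ((i + 1 : ℕ) : ℤ)) = -1 - i - 1 by push_cast; ring, h1, smul_smul,
      show x - ((i + 1 : ℕ) : ℚ) = x - 1 - i by push_cast; ring]
    congr 1
    have := succ_mul_cchoose_succ x i
    push_cast
    linear_combination (-1 : ℂ) ^ i * this

/-! ### Skew-symmetry of the defect on `M` and its vanishing -/

theorem twIter_skew (hσ : A.IsAutomorphism σ) (hN : 0 < N) (hord : σ ^ N = 1)
    (hY : IsEquivariant σ Y) (hv : SatisfiesVacuum A Y) (hA : SatisfiesAssociativity A σ Y)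
    (a b : V) (v : M) (x : ℚ) {n : ℤ} {K : ℕ}
    (hK : ∀ i : ℕ, K ≤ i → ((A.Y b)[[n + i]]) a = 0) (q : ℤ) :
    twIter A Y a b v x n q = -(-1 : ℂ) ^ n • ∑ i ∈ range K, cchoose (x + q) i •
      twIter A Y b a v x (n + i) (q - i) := by
  rw [twIter, A.skew_symmetry, finsum_nat_eq_sum_range (K := K)]
  · have hmap : ∀ (c : ℂ) (w : V), tmode Y (c • w) (x + q) v = c • tmode Y w (x + q) v :=
      fun c w => by rw [tmode_smul, LinearMap.smul_apply]
    have hsum : ∀ F : ℕ → V, tmode Y (∑ i ∈ range K, F i) (x + q) v =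
        ∑ i ∈ range K, tmode Y (F i) (x + q) v := fun F => by
      simp [tmode, Finset.sum_apply]
    rw [hmap, hsum]
    congr 1
    refine sum_congr rfl fun i _ => ?_
    rw [hmap, tmode_vacMode A hσ hN hord hY hv hA, LinearMap.smul_apply, smul_smul, ← mul_assoc,
      neg_one_pow_mul_neg_one_pow, one_mul, twIter]
    congr 3
    push_cast
    ring
  · intro i hi
    rw [hK i hi, map_zero, smul_zero]

/-- Negating the upper index turns this into Vandermonde's identity. -/
theorem sum_cchoose_mul_cchoose_sub (x y : ℚ) (p : ℕ) :
    ∑ ij ∈ antidiagonal p, (-1 : ℂ) ^ ij.1 * (cchoose x ij.1 * cchoose (x + y - ij.1) ij.2) =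
      cchoose y p := by
  have hy := cchoose_neg (-y) p
  rw [neg_neg, show -y + p - 1 = x + (p - 1 - x - y) by ring, cchoose_add, mul_sum] at hy
  rw [hy]
  refine sum_congr rfl fun ij hij => ?_
  obtain rfl := mem_antidiagonal.1 hij
  rw [show x + y - (ij.1 : ℚ) = -(ij.1 - x - y) by ring, cchoose_neg, pow_add,
    show (ij.1 : ℚ) - x - y + ij.2 - 1 = (ij.1 + ij.2 : ℕ) - 1 - x - y by push_cast; ring]
  ring

/-- In series form, `Y^M(Y(a,z-w)b,w)` and `Y^M(Y(b,w-z)a,z)` have the same residues; re-expanding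
in the other variable is `sum_cchoose_mul_cchoose_sub`. -/
theorem iterSum_twIter_skew (hσ : A.IsAutomorphism σ) (hN : 0 < N) (hord : σ ^ N = 1)
    (hY : IsEquivariant σ Y) (hv : SatisfiesVacuum A Y) (hA : SatisfiesAssociativity A σ Y)
    (a b : V) (v : M) (s r : ℚ) (m n k : ℤ) :
    iterSum s (twIter A Y a b v (s + r)) m n k =
      -(-1 : ℂ) ^ n • iterSum r (twIter A Y b a v (r + s)) k n m := by
  obtain ⟨L, hL⟩ := exists_twIter_eq_zero A Y a b
  obtain ⟨L', hL'⟩ := A.exists_ncoeff_eq_zero b a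
  have hz : ∀ (x : ℚ) (n q : ℤ), (L' : ℤ) ≤ n → twIter A Y b a v x n q = 0 := fun x n q hn => by
    rw [twIter, hL' n hn, tmode_zero, LinearMap.zero_apply]
  set K := (max L L' - n).toNat
  rw [iterSum_eq_sum (hL v _) s (K := K) (by omega), iterSum_eq_sum (hz _) r (K := K) (by omega)]
  have h1 : ∀ i : ℕ, cchoose (s + m) i • twIter A Y a b v (s + r) (n + i) (m + k - i) =
      ∑ l ∈ range K, (-(-1 : ℂ) ^ n * ((-1 : ℂ) ^ i *
        (cchoose (s + m) i * cchoose (s + m + (r + k) - i) l))) •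
        twIter A Y b a v (r + s) (n + (i + l : ℕ)) (k + m - (i + l : ℕ)) := by
    intro i
    rw [twIter_skew A hσ hN hord hY hv hA a b v (s + r) (K := K)
      fun l hl => hL' _ (by omega), smul_smul, smul_sum]
    refine sum_congr rfl fun l _ => ?_
    rw [smul_smul, zpow_add₀ (by norm_num), zpow_natCast,
      show s + r + (m + k - i : ℤ) = s + m + (r + k) - i by push_cast; ring,
      show n + (i : ℤ) + l = n + (i + l : ℕ) by push_cast; ring,
      show m + k - (i : ℤ) - l = k + m - (i + l : ℕ) by push_cast; ring, add_comm s r]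
    congr 1
    ring
  simp only [h1]
  rw [sum_range_sum_range_eq_sum_antidiagonal, smul_sum]
  · refine sum_congr rfl fun p _ => ?_
    rw [← sum_cchoose_mul_cchoose_sub (s + m), smul_smul, mul_sum, sum_smul]
    refine sum_congr rfl fun ij hij => ?_
    rw [mem_antidiagonal.1 hij]
  · intro i l hil
    rw [hz _ _ _ (by omega), smul_zero]

theorem twDefect_skew (hσ : A.IsAutomorphism σ) (hN : 0 < N) (hord : σ ^ N = 1)
    (hY : IsEquivariant σ Y) (hv : SatisfiesVacuum A Y) (hA : SatisfiesAssociativity A σ Y)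
    (a b : V) (v : M) (s r : ℚ) (m n k : ℤ) :
    twDefect A Y a b v s r m n k = -(-1 : ℂ) ^ n • twDefect A Y b a v r s k n m := by
  rw [twDefect, twDefect, borcherdsDefect, borcherdsDefect,
    iterSum_twIter_skew A hσ hN hord hY hv hA a b]
  have h : (-1 : ℂ) ^ n * (-1) ^ n = 1 := by
    rw [← zpow_add₀ (by norm_num), Even.neg_one_zpow ⟨n, rfl⟩]
  rw [smul_add, smul_sub, smul_smul (-(-1 : ℂ) ^ n) ((-1) ^ n), neg_mul, h]
  module

/-- For `m` large, associativity equates iterate and product, and the reversed product vanishes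
since the modes of `a` involved kill `v`. -/
theorem exists_twDefect_eq_zero (hY : IsEquivariant σ Y)
    (hA : SatisfiesAssociativity A σ Y) {j : ℕ} (hj : j < N) {a : V}
    (ha : InEigenspace σ N j a) (b : V) (v : M) (r : ℚ) :
    ∃ m₀ : ℤ, ∀ m n k : ℤ, m₀ ≤ m → twDefect A Y a b v ((j : ℚ) / N) r m n k = 0 := by
  obtain ⟨n₀, hn₀⟩ := hA j hj a ha b v
  obtain ⟨B, hB⟩ := exists_twProd_eq_zero Y b a v r ((j : ℚ) / N)
  refine ⟨max n₀ B, fun m n k hm => ?_⟩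
  lift m to ℕ using by omega
  have h := (assocIdentity_iff A hY ha b v m).1 (hn₀ m (by omega)) r n k
  rw [twDefect, borcherdsDefect, h, prodSum_eq_zero hB (by omega), sub_self, smul_zero, add_zero]

theorem twDefect_add (a b b' : V) (v : M) (s r : ℚ) (m n k : ℤ) :
    twDefect A Y a (b + b') v s r m n k =
      twDefect A Y a b v s r m n k + twDefect A Y a b' v s r m n k := by
  obtain ⟨L, hL⟩ := exists_twIter_eq_zero A Y a b
  obtain ⟨L', hL'⟩ := exists_twIter_eq_zero A Y a b'
  obtain ⟨B, hB⟩ := exists_twProd_eq_zero Y a b v s r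
  obtain ⟨B', hB'⟩ := exists_twProd_eq_zero Y a b' v s r
  obtain ⟨C, hC⟩ := exists_twProd_eq_zero Y b a v r s
  obtain ⟨C', hC'⟩ := exists_twProd_eq_zero Y b' a v r s
  have h1 : twIter A Y a (b + b') v (s + r) =
      twIter A Y a b v (s + r) + twIter A Y a b' v (s + r) := by
    funext n q
    simp only [twIter, Pi.add_apply, map_add, tmode_add, LinearMap.add_apply]
  have h2 : twProd Y a (b + b') v s r = twProd Y a b v s r + twProd Y a b' v s r := by
    funext n q
    simp only [twProd, Pi.add_apply, map_add, tmode_add, LinearMap.add_apply]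
  have h3 : twProd Y (b + b') a v r s = twProd Y b a v r s + twProd Y b' a v r s := by
    funext n q
    simp only [twProd, Pi.add_apply, tmode_add, LinearMap.add_apply]
  simp only [twDefect, borcherdsDefect]
  rw [h1, h2, h3, iterSum_add (hL v _) (hL' v _), prodSum_add hB hB', prodSum_add hC hC']
  module

theorem twDefect_add_intCast (a b : V) (v : M) (s r : ℚ) (p m n k : ℤ) :
    twDefect A Y a b v s (r + p) m n k = twDefect A Y a b v s r m n (k + p) := by
  simp only [twDefect, borcherdsDefect]
  congr 1
  · congr 1
    · refine finsum_congr fun i => ?_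
      rw [twIter, twIter, show s + (r + p) + (m + k - i : ℤ) = s + r + (m + (k + p) - i : ℤ) by
        push_cast; ring]
    · refine finsum_congr fun i => ?_
      rw [twProd, twProd, show r + p + (k + i : ℤ) = r + (k + p + i : ℤ) by push_cast; ring]
  · congr 1
    refine finsum_congr fun i => ?_
    rw [twProd, twProd, show r + p + (k + n - i : ℤ) = r + (k + p + n - i : ℤ) by push_cast; ring]

theorem twDefect_eq_zero (hσ : A.IsAutomorphism σ) (hN : 0 < N) (hord : σ ^ N = 1)
    (hY : IsEquivariant σ Y) (hv : SatisfiesVacuum A Y) (hA : SatisfiesAssociativity A σ Y)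
    {j : ℕ} (hj : j < N) {a : V} (ha : InEigenspace σ N j a) (b : V) (v : M) (r : ℚ)
    (m n k : ℤ) : twDefect A Y a b v ((j : ℚ) / N) r m n k = 0 := by
  refine eigenspace_induction (P := fun b => twDefect A Y a b v ((j : ℚ) / N) r m n k = 0)
    hN hord (fun b b' hb hb' => ?_) (fun l hl b hb => ?_) b
  · rw [twDefect_add, hb, hb', add_zero]
  -- Associativity for `(b, a)` controls only `r` in `l/N + ℤ`. In any other coset the modes of `b`,
  -- and those of `a_(n) b` entering the iterate, are all zero.
  by_cases hr : ∃ p : ℤ, r = (l : ℚ) / N + p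
  · obtain ⟨p, rfl⟩ := hr
    obtain ⟨m₀, hm₀⟩ := exists_twDefect_eq_zero A hY hA hj ha b v ((l : ℚ) / N)
    obtain ⟨k₀, hk₀⟩ := exists_twDefect_eq_zero A hY hA hl hb a v ((j : ℚ) / N)
    rw [twDefect_add_intCast]
    refine eq_zero_of_recursion (twDefect_succ A Y a b v _ _) (k₀ := k₀) hm₀ (fun m n k hk => ?_)
      _ _ _
    rw [twDefect_skew A hσ hN hord hY hv hA, hk₀ k n m hk, smul_zero]
  · push Not at hr
    have hb0 : ∀ q : ℤ, tmode Y b (r + q) = 0 := fun q =>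
      tmode_eq_zero_of_eigenspace hY hb fun p hp => hr (p - q) (by push_cast; linarith)
    have h1 : twIter A Y a b v ((j : ℚ) / N + r) = 0 := by
      funext n q
      rw [twIter, tmode_eq_zero_of_eigenspace hY (ha.ncoeff hσ hb n)]
      · rfl
      · intro p hp
        refine hr (p - q) ?_
        push_cast [add_div] at hp ⊢
        linarith
    have h2 : twProd Y a b v ((j : ℚ) / N) r = 0 := by
      funext p q
      rw [twProd, hb0, LinearMap.zero_apply, map_zero]
      rfl
    have h3 : twProd Y b a v r ((j : ℚ) / N) = 0 := by
      funext p q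
      rw [twProd, hb0]
      rfl
    rw [twDefect, h1, h2, h3]
    simp [borcherdsDefect, iterSum, prodSum]

/-! ### Implications between the three conditions -/

theorem SatisfiesExplicitAssociativity.satisfiesAssociativity
    (h : SatisfiesExplicitAssociativity A σ Y) : SatisfiesAssociativity A σ Y := by
  intro j hj a ha b v
  obtain ⟨B, hB⟩ := (Y a).2.2 v
  refine ⟨⌈B⌉.toNat, fun n hn => h j hj a ha b v n fun k hk => hB _ ?_⟩
  have h1 : B ≤ ⌈B⌉ := Int.le_ceil B
  have h2 : ((⌈B⌉ : ℤ) : ℚ) ≤ (k : ℤ) := by exact_mod_cast (by omega : ⌈B⌉ ≤ (k : ℤ))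
  have h3 : (0 : ℚ) ≤ (j : ℚ) / N := by positivity
  push_cast at h2
  linarith

theorem IsTwistedModule.satisfiesExplicitAssociativity
    (h : IsTwistedModule A σ Y) : SatisfiesExplicitAssociativity A σ Y := by
  intro j hj a ha b v n hn
  have := (assocIdentity_iff A h.equivariant ha b v n).2 fun r n' k => ?_
  · exact_mod_cast this
  have h1 := (satisfiesTwistedBorcherds_iff A Y σ).1 h.borcherds j hj a ha b v r n n' k
  -- The assumption on `n` is exactly what kills every mode of `a` acting first in the reversed
  -- product; `b` plays no role.
  have h2 : prodSum (twProd Y b a v r ((j : ℚ) / N)) k n' n = 0 := by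
    rw [prodSum, finsum_nat_eq_sum_range (K := 0), sum_range_zero]
    intro i _
    have := hn (n + i) (by omega)
    rw [add_comm, Nat.cast_add] at this
    rw [twProd]
    push_cast
    rw [this, map_zero, smul_zero]
  rwa [twDefect, borcherdsDefect, h2, smul_zero, add_zero, sub_eq_zero] at h1

theorem isTwistedModule_of_satisfiesAssociativity (hσ : A.IsAutomorphism σ) (hN : 0 < N)
    (hord : σ ^ N = 1) (hY : IsEquivariant σ Y) (hv : SatisfiesVacuum A Y)
    (hA : SatisfiesAssociativity A σ Y) : IsTwistedModule A σ Y where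
  equivariant := hY
  vacuum := hv
  borcherds := (satisfiesTwistedBorcherds_iff A Y σ).2 fun _ hj _ ha b v r m n k =>
    twDefect_eq_zero A hσ hN hord hY hv hA hj ha b v r m n k

end VertexAlgebra

end

theorem mainTheorem3 {V : Type*} [AddCommGroup V] [Module ℂ V] (A : VertexAlgebra V)
    (σ : V ≃ₗ[ℂ] V) (hσ : A.IsAutomorphism σ) (N : ℕ) (hN : 0 < N) (hord : orderOf σ = N)
    {M : Type*} [AddCommGroup M] [Module ℂ M] (Y : V →ₗ[ℂ] TwistedField N M) :
    (A.IsTwistedModule σ Y ↔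
      VertexAlgebra.IsEquivariant σ Y ∧ A.SatisfiesVacuum Y ∧ A.SatisfiesAssociativity σ Y) ∧
    (A.IsTwistedModule σ Y ↔
      VertexAlgebra.IsEquivariant σ Y ∧ A.SatisfiesVacuum Y ∧
        A.SatisfiesExplicitAssociativity σ Y) := by
  have hpow : σ ^ N = 1 := hord ▸ pow_orderOf_eq_one σ
  have hexp (h : A.IsTwistedModule σ Y) := h.satisfiesExplicitAssociativity A
  refine ⟨⟨fun h => ⟨h.equivariant, h.vacuum, (hexp h).satisfiesAssociativity⟩, fun h => ?_⟩,
    ⟨fun h => ⟨h.equivariant, h.vacuum, hexp h⟩, fun h => ?_⟩⟩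
  · exact A.isTwistedModule_of_satisfiesAssociativity hσ hN hpow h.1 h.2.1 h.2.2
  · exact A.isTwistedModule_of_satisfiesAssociativity hσ hN hpow h.1 h.2.1
      h.2.2.satisfiesAssociativity
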